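/- Let $G_2:=\bigoplus_{n=1}^{\infty}\mathbb Z/2\mathbb Z$. A set $S\subseteq G_2$ is syndetic if $S+F=G_2$ for some finite $F\subseteq G_2$; a set $B\subseteq G_2$ is piecewise syndetic if there is a syndetic set $S\subseteq G_2$ such that for every finite $F\subseteq S$ there is $g\in G_2$ with $F+g\subseteq B$. A Følner sequence for $G_2$ is a sequence $\mathbf\Phi=(\Phi_n)_{n\in\mathbb N}$ of finite subsets of $G_2$ with $\lim_{n\to\infty}\frac{|(\Phi_n+g)\cap\Phi_n|}{|\Phi_n|}=1$ for every $g\in G_2$. The upper Banach density of $A\subseteq G_2$ is $$d^*(A):=\sup\Big\{\limsup_{n\to\infty}\frac{|A\cap\Phi_n|}{|\Phi_n|} : (\Phi_n)_{n\in\mathbb N}\text{ is a Følner sequence for } G_2\Big\}.$$ Theorem. For every $\varepsilon>0$ there is a set $A\subseteq G_2$ such that $d^*(A)>\frac12-\varepsilon$ and the difference set $A-A=\{a-a':a,a'\in A\}$ does not contain any set of the form $B-B+g$ with $B\subseteq G_2$ piecewise syndetic and $g\in G_2$. -/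

import Mathlib

open Filter Topology
open scoped Pointwise

/-- The countable direct sum of copies of `ℤ/2ℤ`. -/
abbrev G2 : Type := DirectSum ℕ (fun _ => ZMod 2)

/-- `A` is syndetic: finitely many translates of `A` cover the group. -/
def IsSyndetic {G : Type*} [AddCommGroup G] (A : Set G) : Prop :=
  ∃ F : Finset G, A + (F : Set G) = Set.univ

/-- `A` is piecewise syndetic: there is a syndetic set `S` such that every finite subset of `S`
has a translate contained in `A`. -/
def IsPiecewiseSyndetic {G : Type*} [AddCommGroup G] (A : Set G) : Prop :=
  ∃ S : Set G, IsSyndetic S ∧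
    ∀ F : Finset G, (F : Set G) ⊆ S → ∃ g : G, (F : Set G) + {g} ⊆ A

/-- A Følner sequence: finite sets `Φ n` with `|(Φ n + g) ∩ Φ n| / |Φ n| → 1` for every `g`.
(As `0 / 0 = 0`, the limit forces `Φ n` to be nonempty for all large `n`.) -/
def IsFolnerSeq {G : Type*} [AddCommGroup G] (Φ : ℕ → Finset G) : Prop :=
  ∀ g : G, Tendsto
    (fun n => ((((Φ n : Set G) + {g}) ∩ (Φ n : Set G)).ncard : ℝ) / ((Φ n).card : ℝ))
    atTop (𝓝 1)

/-- The upper density of `A` with respect to the sequence `Φ`. The quotients lie in `[0, 1]`,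
so this is a genuine upper limit. -/
noncomputable def upperDensity {G : Type*} [AddCommGroup G] (Φ : ℕ → Finset G) (A : Set G) : ℝ :=
  limsup (fun n => ((A ∩ (Φ n : Set G)).ncard : ℝ) / ((Φ n).card : ℝ)) atTop

/-- The upper Banach density of `A`: the supremum, over all Følner sequences, of the upper
density. (The set of values is bounded by `1`.) -/
noncomputable def upperBanachDensity {G : Type*} [AddCommGroup G] (A : Set G) : ℝ :=
  sSup {d : ℝ | ∃ Φ : ℕ → Finset G, IsFolnerSeq Φ ∧ d = upperDensity Φ A}

/-! An element of `G2` is a finite set of naturals, with symmetric difference as addition. If `B` is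
piecewise syndetic, some finite colouring has all its monochromatic differences in `B - B`. So it
suffices to find a set `A` of density near 1/2 such that for all `k` and `g`, every `k`-colouring
has `P`, `Q` of one colour with `P - Q + g` outside `A - A`.

There are countably many pairs `(g, k)`, and each is handled by one modification of a set that
depends on finitely many coordinates and has no difference `{0}`. On a fresh block `I` of `2N`
coordinates, keep the set where clearly fewer than `N` elements of `I` are used, translate it by
`{0} + g` where clearly more are used, and discard the layers between (`twist`). The loss is small
because central binomial coefficients are `o(4^N)`. If `u ⊆ I` has at least `2N - k` elements, `u +
g` is no longer a difference (`twist_avoids`).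

A `k`-colouring of the subsets of `I` always has a monochromatic pair at distance at least `2N - k`
(`exists_monochromatic_far_pair`). This topological input comes from the octahedral Tucker lemma,
proved by counting alternating simplices modulo 2 over hemispheres. -/

/-! ### Mod 2 cochains, prisms and cones -/

/-- The simplicial coboundary, modulo 2, of a cochain on ordered simplices. -/
def coboundary {V : Type*} : (List V → ZMod 2) → List V → ZMod 2
  | _, [] => 0
  | f, x :: l => f l + coboundary (fun t => f (x :: t)) l

/-- The dual of the prism operator of a map `φ`. -/
def prism {V : Type*} (φ : V → V) : (List V → ZMod 2) → List V → ZMod 2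
  | _, [] => 0
  | f, x :: l => f (x :: φ x :: l.map φ) + prism φ (fun t => f (x :: t)) l

/-- The dual of the contraction that pushes along `φ` and then to the apex `e`. -/
def coneOff {V : Type*} (φ : V → V) (e : V) (f : List V → ZMod 2) (l : List V) : ZMod 2 :=
  f (e :: l.map φ) + prism φ f l

theorem coboundary_add {V : Type*} (f g : List V → ZMod 2) (l : List V) :
    coboundary (fun t => f t + g t) l = coboundary f l + coboundary g l := by
  induction l generalizing f g with
  | nil => simp [coboundary]
  | cons x l ih => simp only [coboundary, ih]; ring

theorem coboundary_map {V W : Type*} (φ : V → W) (f : List W → ZMod 2) (l : List V) :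
    coboundary (fun t => f (t.map φ)) l = coboundary f (l.map φ) := by
  induction l generalizing f with
  | nil => simp [coboundary]
  | cons x l ih =>
    simp only [coboundary, List.map_cons]
    rw [ih (fun t => f (φ x :: t))]

theorem coboundary_congr {V : Type*} (f g : List V → ZMod 2) (l : List V)
    (h : ∀ t, t.Sublist l → f t = g t) : coboundary f l = coboundary g l := by
  induction l generalizing f g with
  | nil => simp [coboundary]
  | cons x l ih =>
    simp only [coboundary]
    rw [h l (List.sublist_cons_self x l)]
    rw [ih _ _ fun t ht => h (x :: t) (ht.cons_cons x)]

theorem coboundary_perm {V : Type*} (f : List V → ZMod 2)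
    (hf : ∀ s t : List V, s.Perm t → f s = f t) {l l' : List V} (h : l.Perm l') :
    coboundary f l = coboundary f l' := by
  induction h generalizing f with
  | nil => rfl
  | cons x h ih =>
    simp only [coboundary]
    rw [hf _ _ h, ih _ fun s t hst => hf _ _ (hst.cons x)]
  | swap x y l =>
    simp only [coboundary]
    have : (fun t => f (y :: x :: t)) = fun t => f (x :: y :: t) :=
      funext fun t => hf _ _ (List.Perm.swap x y t)
    rw [this]; ring
  | trans _ _ ih₁ ih₂ => rw [ih₁ f hf, ih₂ f hf]

theorem prism_add {V : Type*} (φ : V → V) (f g : List V → ZMod 2) (l : List V) :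
    prism φ (fun t => f t + g t) l = prism φ f l + prism φ g l := by
  induction l generalizing f g with
  | nil => simp [prism]
  | cons x l ih => simp only [prism, ih]; ring

theorem coneOff_add {V : Type*} (φ : V → V) (e : V) (f g : List V → ZMod 2) (l : List V) :
    coneOff φ e (fun t => f t + g t) l = coneOff φ e f l + coneOff φ e g l := by
  simp only [coneOff, prism_add]; ring

theorem prism_congr {V : Type*} (φ : V → V) (f g : List V → ZMod 2) (l : List V)
    (h : ∀ l₁ x l₂, l = l₁ ++ x :: l₂ →
      f (l₁ ++ x :: φ x :: l₂.map φ) = g (l₁ ++ x :: φ x :: l₂.map φ)) :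
    prism φ f l = prism φ g l := by
  induction l generalizing f g with
  | nil => simp [prism]
  | cons x l ih =>
    simp only [prism]
    rw [show f (x :: φ x :: l.map φ) = g (x :: φ x :: l.map φ) from h [] x l rfl]
    rw [ih _ (fun t => g (x :: t)) fun l₁ y l₂ hl => h (x :: l₁) y l₂ (by simp [hl])]

/-- The chain homotopy between the identity and `φ`, in dual form. -/
theorem prism_coboundary {V : Type*} (φ : V → V) (f : List V → ZMod 2) (l : List V) :
    prism φ (coboundary f) l = f l + f (l.map φ) + coboundary (prism φ f) l := by
  induction l generalizing f with
  | nil => simp [prism, coboundary, CharTwo.add_self_eq_zero]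
  | cons x l ih =>
    have h := ih fun t => f (x :: t)
    simp only [prism, coboundary, List.map_cons, prism_add, coboundary_add] at h ⊢
    rw [h, coboundary_map φ (fun t => f (x :: φ x :: t))]
    linear_combination
      (CharTwo.add_self_eq_zero (f (x :: l.map φ)))

/-- The prism moves `l` to its image under `φ` and the cone contracts that image to `e`, so the two
copies of the `φ`-image cancel. -/
theorem coneOff_coboundary {V : Type*} (φ : V → V) (e : V) (f : List V → ZMod 2) (l : List V) :
    coneOff φ e (coboundary f) l = f l + coboundary (coneOff φ e f) l := by
  have h : coboundary (coneOff φ e f) l =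
      coboundary (fun t => f (e :: t)) (l.map φ) + coboundary (prism φ f) l := by
    rw [← coboundary_map, ← coboundary_add]; rfl
  rw [h]
  simp only [coneOff, prism_coboundary, coboundary]
  linear_combination CharTwo.add_self_eq_zero (f (l.map φ))

/-! ### Hemispheres of the octahedral sphere -/

/-- The sum of a cochain over the triangulated upper hemisphere of the octahedral sphere of
dimension `i`. -/
def hemisphere : ℕ → (List (ℕ → SignType) → ZMod 2) → ZMod 2
  | 0, f => f [Function.update 0 0 1]
  | i + 1, f =>
    hemisphere i (coneOff (Function.update · (i + 1) 1) (Function.update 0 (i + 1) 1) f) +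
    hemisphere i fun l =>
      coneOff (Function.update · (i + 1) 1) (Function.update 0 (i + 1) 1) f (l.map Neg.neg)

theorem hemisphere_add (i : ℕ) (f g : List (ℕ → SignType) → ZMod 2) :
    hemisphere i (fun t => f t + g t) = hemisphere i f + hemisphere i g := by
  induction i generalizing f g with
  | zero => simp [hemisphere]
  | succ i ih =>
    have h : coneOff (Function.update · (i + 1) 1) (Function.update 0 (i + 1) 1)
        (fun t : List (ℕ → SignType) => f t + g t) = fun l => _ := funext (coneOff_add _ _ f g)
    simp only [hemisphere, h, ih]; ring

/-- The hemisphere is the cone over the sphere one dimension lower. By `coneOff_coboundary` its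
boundary is that sphere plus a term that vanishes because the sphere is a cycle. The cycle property
is a hypothesis since it is proved from this lemma by induction. -/
theorem hemisphere_succ_of_cycle (i : ℕ)
    (hi : ∀ g, hemisphere i (coboundary g) +
      hemisphere i (coboundary fun l => g (l.map Neg.neg)) = 0)
    (f : List (ℕ → SignType) → ZMod 2) :
    hemisphere (i + 1) (coboundary f) =
      hemisphere i f + hemisphere i fun l => f (l.map Neg.neg) := by
  have h : coneOff (Function.update · (i + 1) 1) (Function.update 0 (i + 1) 1) (coboundary f) =
    fun l : List (ℕ → SignType) => _ := funext (coneOff_coboundary _ _ f)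
  have h' := hi (coneOff (Function.update · (i + 1) 1) (Function.update 0 (i + 1) 1) f)
  have h2 := funext (coboundary_map (Neg.neg : (ℕ → SignType) → _)
    (coneOff (Function.update · (i + 1) 1) (Function.update 0 (i + 1) 1) f))
  rw [h2] at h'
  simp only [hemisphere, h, hemisphere_add]
  linear_combination h'

theorem hemisphere_cycle (i : ℕ) (g : List (ℕ → SignType) → ZMod 2) :
    hemisphere i (coboundary g) + hemisphere i (coboundary fun l => g (l.map Neg.neg)) = 0 := by
  induction i generalizing g with
  | zero => simp [hemisphere, coboundary, CharTwo.add_self_eq_zero]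
  | succ i ih =>
    rw [hemisphere_succ_of_cycle i ih, hemisphere_succ_of_cycle i ih]
    simp only [List.map_map, show (Neg.neg ∘ Neg.neg : (ℕ → SignType) → _) = id from
      funext neg_neg, List.map_id]
    linear_combination CharTwo.add_self_eq_zero (hemisphere i g) +
      CharTwo.add_self_eq_zero (hemisphere i fun l => g (l.map Neg.neg))

theorem hemisphere_succ_coboundary (i : ℕ) (f : List (ℕ → SignType) → ZMod 2) :
    hemisphere (i + 1) (coboundary f) =
      hemisphere i f + hemisphere i fun l => f (l.map Neg.neg) :=
  hemisphere_succ_of_cycle i (hemisphere_cycle i) f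

/-- The sign vector `y` extends the sign vector `x`. -/
def SignExtends (x y : ℕ → SignType) : Prop := ∀ j, x j ≠ 0 → y j = x j

/-- Chains of `d` nonzero sign vectors on the first `d` coordinates. -/
structure IsSignChain (d : ℕ) (l : List (ℕ → SignType)) : Prop where
  length_eq : l.length = d
  pairwise : l.Pairwise SignExtends
  ne_zero : ∀ x ∈ l, x ≠ 0
  eq_zero_of_le : ∀ x ∈ l, ∀ j, d ≤ j → x j = 0

theorem IsSignChain.neg {d : ℕ} {l : List (ℕ → SignType)} (h : IsSignChain d l) :
    IsSignChain d (l.map Neg.neg) := by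
  refine ⟨by simp [h.length_eq], ?_, ?_, ?_⟩
  · rw [List.pairwise_map]
    refine h.pairwise.imp fun {x y} hxy j hj => ?_
    have : x j ≠ 0 := fun h0 => hj (by simp [h0])
    simp [hxy j this]
  · intro x hx
    obtain ⟨y, hy, rfl⟩ := List.mem_map.1 hx
    exact fun h0 => h.ne_zero y hy (funext fun j => by simpa using congrFun h0 j)
  · intro x hx j hj
    obtain ⟨y, hy, rfl⟩ := List.mem_map.1 hx
    simp [h.eq_zero_of_le y hy j hj]

theorem SignExtends.trans {x y z : ℕ → SignType} (h : SignExtends x y) (h' : SignExtends y z) :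
    SignExtends x z := fun j hj => by
  have := h j hj
  rw [← this] at hj ⊢
  exact h' j hj

theorem SignExtends.update {x y : ℕ → SignType} (h : SignExtends x y) (i : ℕ) (a : SignType) :
    SignExtends (Function.update x i a) (Function.update y i a) := fun j hj => by
  by_cases hji : j = i
  · simp [hji]
  · simp only [Function.update_of_ne hji] at hj ⊢
    exact h j hj

theorem SignExtends.zero (y : ℕ → SignType) : SignExtends 0 y := fun _ hj => absurd rfl hj

theorem SignExtends.self_update {x : ℕ → SignType} {i : ℕ} (h : x i = 0) (a : SignType) :
    SignExtends x (Function.update x i a) := fun j hj => by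
  rw [Function.update_of_ne]
  rintro rfl
  exact hj h

theorem update_one_ne_zero (x : ℕ → SignType) (i : ℕ) : Function.update x i 1 ≠ 0 := fun h => by
  simpa using congrFun h i

theorem IsSignChain.cone {d : ℕ} {l : List (ℕ → SignType)} (h : IsSignChain d l) :
    IsSignChain (d + 1) (Function.update 0 d 1 :: l.map (Function.update · d 1)) := by
  refine ⟨by simp [h.length_eq], ?_, ?_, ?_⟩
  · rw [List.pairwise_cons, List.pairwise_map]
    refine ⟨?_, h.pairwise.imp fun hxy => hxy.update d 1⟩
    simp only [List.mem_map, forall_exists_index, and_imp, forall_apply_eq_imp_iff₂]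
    exact fun x _ => (SignExtends.zero x).update d 1
  · simp only [List.mem_cons, List.mem_map, forall_eq_or_imp, forall_exists_index, and_imp,
      forall_apply_eq_imp_iff₂]
    exact ⟨update_one_ne_zero _ _, fun _ _ => update_one_ne_zero _ _⟩
  · simp only [List.mem_cons, List.mem_map, forall_eq_or_imp, forall_exists_index, and_imp,
      forall_apply_eq_imp_iff₂]
    refine ⟨fun j hj => ?_, fun x hx j hj => ?_⟩ <;> rw [Function.update_of_ne (by omega)]
    · rfl
    · exact h.eq_zero_of_le x hx j (by omega)

theorem IsSignChain.prism {d : ℕ} {l₁ l₂ : List (ℕ → SignType)} {x : ℕ → SignType}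
    (h : IsSignChain d (l₁ ++ x :: l₂)) :
    IsSignChain (d + 1)
      (l₁ ++ x :: Function.update x d 1 :: l₂.map (Function.update · d 1)) := by
  obtain ⟨h1, h2, h3, h4⟩ := h
  have hs : ∀ y ∈ l₁ ++ x :: l₂, SignExtends y (Function.update y d 1) := fun y hy =>
    SignExtends.self_update (h4 y hy d le_rfl) 1
  simp only [List.pairwise_append, List.pairwise_cons, List.mem_cons, List.mem_append,
    or_imp, forall_and, List.length_append, List.length_cons, forall_eq] at h1 h2 h3 h4 hs
  refine ⟨by simp; omega, ?_, ?_, ?_⟩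
  · simp only [List.pairwise_append, List.pairwise_cons, List.mem_cons, List.mem_map,
      forall_eq_or_imp, forall_exists_index, and_imp, forall_apply_eq_imp_iff₂,
      List.pairwise_map]
    obtain ⟨p1, ⟨p2, p3⟩, p4, p5⟩ := h2
    exact ⟨p1, ⟨⟨hs.2.1, fun y hy => (p2 y hy).trans (hs.2.2 y hy)⟩,
      fun y hy => (p2 y hy).update d 1, p3.imp fun hxy => hxy.update d 1⟩,
      fun y hy => ⟨p4 y hy, (p4 y hy).trans hs.2.1, fun z hz =>
        (p5 y hy z hz).trans (hs.2.2 z hz)⟩⟩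
  · simp only [List.mem_append, List.mem_cons, List.mem_map]
    rintro y (hy | rfl | rfl | ⟨z, _, rfl⟩)
    · exact h3.1 y hy
    · exact h3.2.1
    · exact update_one_ne_zero _ _
    · exact update_one_ne_zero _ _
  · simp only [List.mem_append, List.mem_cons, List.mem_map]
    rintro y (hy | rfl | rfl | ⟨z, hz, rfl⟩) j hj
    · exact h4.1 y hy j (by omega)
    · exact h4.2.1 j (by omega)
    · rw [Function.update_of_ne (by omega)]; exact h4.2.1 j (by omega)
    · rw [Function.update_of_ne (by omega)]; exact h4.2.2 z hz j (by omega)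

/-- The cone and the prism over a sign chain consist of sign chains one longer, so hemispheres
involve no other lists. -/
theorem hemisphere_congr (i : ℕ) (f g : List (ℕ → SignType) → ZMod 2)
    (h : ∀ l, IsSignChain (i + 1) l → f l = g l) : hemisphere i f = hemisphere i g := by
  induction i generalizing f g with
  | zero =>
    refine h _ ⟨rfl, List.pairwise_singleton _ _, ?_, ?_⟩
    · simp
    · simp only [List.mem_singleton, forall_eq]
      intro j hj
      rw [Function.update_of_ne (by omega)]; rfl
  | succ i ih =>
    have key : ∀ l, IsSignChain (i + 1) l →
        coneOff (Function.update · (i + 1) 1) (Function.update 0 (i + 1) 1) f l =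
        coneOff (Function.update · (i + 1) 1) (Function.update 0 (i + 1) 1) g l := by
      intro l hl
      unfold coneOff
      rw [h _ hl.cone, prism_congr _ f g l]
      rintro l₁ x l₂ rfl
      exact h _ hl.prism
    simp only [hemisphere]
    rw [ih _ _ key, ih _ _ fun l hl => key _ hl.neg]

/-! ### Alternating labels and the Tucker lemma -/

/-- The indicator of the lists that alternate and start with `b`. -/
def altFrom : Bool → List Bool → ZMod 2
  | _, [] => 1
  | b, c :: l => if c = b then altFrom (!b) l else 0

theorem altFrom_map_not (b : Bool) (l : List Bool) :
    altFrom b (l.map not) = altFrom (!b) l := by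
  induction l generalizing b with
  | nil => rfl
  | cons c l ih => cases b <;> cases c <;> simp [altFrom, ih]

theorem coboundary_zero {V : Type*} (l : List V) : coboundary (fun _ => 0) l = 0 := by
  induction l with
  | nil => rfl
  | cons x l ih => simp [coboundary, ih]

/-- An alternating nonempty list has exactly one face that alternates and starts with `b`: delete
the last entry if the list starts with `b`, the first entry otherwise. In any other list the number
of such faces is zero or two. -/
theorem coboundary_altFrom (b : Bool) (l : List Bool) :
    coboundary (altFrom b) l = altFrom b l + altFrom (!b) l := by
  induction l generalizing b with
  | nil => simp [coboundary, altFrom, CharTwo.add_self_eq_zero]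
  | cons c l ih =>
    by_cases hc : c = b
    · subst hc
      simp only [coboundary, altFrom, if_true, ih, Bool.not_not, Bool.eq_not_self, if_false]
      linear_combination CharTwo.add_self_eq_zero (altFrom c l)
    · have hc' : c = !b := by cases b <;> cases c <;> simp_all
      subst hc'
      simp [coboundary, altFrom, coboundary_zero]

theorem altFrom_ne_zero {b : Bool} {l : List Bool} (h : altFrom b l ≠ 0) :
    l.IsChain (· ≠ ·) := by
  have aux : ∀ (l : List Bool) (b : Bool), altFrom b l ≠ 0 → (∀ c ∈ l.head?, c = b) ∧
      l.IsChain (· ≠ ·) := by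
    intro l
    induction l with
    | nil => simp
    | cons c l ih =>
      intro b h
      simp only [altFrom, ne_eq, ite_eq_right_iff, not_forall] at h
      obtain ⟨rfl, h⟩ := h
      obtain ⟨h1, h2⟩ := ih _ h
      refine ⟨by simp, ?_⟩
      rw [List.isChain_cons]
      refine ⟨fun y hy => ?_, h2⟩
      rw [h1 y hy]; simp
  exact (aux l b h).2

/-- The indicator of the label lists that, sorted by absolute value, alternate in sign and
start with the sign `true`. -/
def altLabels (l : List (ℕ ×ₗ Bool)) : ZMod 2 :=
  altFrom true ((l.insertionSort (· ≤ ·)).map fun p => (ofLex p).2)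

theorem altLabels_perm (l l' : List (ℕ ×ₗ Bool)) (h : l.Perm l') :
    altLabels l = altLabels l' := by
  unfold altLabels
  rw [show l.insertionSort (· ≤ ·) = l'.insertionSort (· ≤ ·) from
    (((l.perm_insertionSort _).trans h).trans (l'.perm_insertionSort _).symm).eq_of_pairwise
      (fun a b _ _ => le_antisymm) (l.pairwise_insertionSort _) (l'.pairwise_insertionSort _)]

/-- No two labels in the list are opposite. -/
def NoOpposite (l : List (ℕ ×ₗ Bool)) : Prop :=
  ∀ p ∈ l, ∀ q ∈ l, (ofLex p).1 = (ofLex q).1 → (ofLex p).2 = (ofLex q).2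

/-- The opposite label. -/
def flipLabel (p : ℕ ×ₗ Bool) : ℕ ×ₗ Bool := toLex ((ofLex p).1, !(ofLex p).2)

theorem altLabels_of_sorted {l : List (ℕ ×ₗ Bool)} (h : l.Pairwise (· ≤ ·)) :
    altLabels l = altFrom true (l.map fun p => (ofLex p).2) := by
  unfold altLabels
  rw [h.insertionSort_eq]

/-- Without opposite labels, equal absolute values carry equal signs, so flipping all signs
preserves the sorted order and the claim reduces to sign lists. -/
theorem coboundary_altLabels {l : List (ℕ ×ₗ Bool)} (h : NoOpposite l) :
    coboundary altLabels l = altLabels l + altLabels (l.map flipLabel) := by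
  set s := l.insertionSort (· ≤ ·) with hs
  have hp : s.Perm l := l.perm_insertionSort _
  have hsort : s.Pairwise (· ≤ ·) := l.pairwise_insertionSort _
  have hflip : (s.map flipLabel).Pairwise (· ≤ ·) := by
    rw [List.pairwise_map]
    refine hsort.imp_of_mem fun {p q} hpm hqm hpq => ?_
    rw [Prod.Lex.le_iff] at hpq ⊢
    rcases hpq with hpq | ⟨hpq, -⟩
    · exact Or.inl hpq
    · refine Or.inr ⟨hpq, ?_⟩
      simp [flipLabel, h p (hp.subset hpm) q (hp.subset hqm) hpq]
  rw [← coboundary_perm altLabels altLabels_perm hp, ← altLabels_perm _ _ hp,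
    ← altLabels_perm _ _ (hp.map flipLabel), altLabels_of_sorted hsort, altLabels_of_sorted hflip,
    coboundary_congr altLabels (fun t => altFrom true (t.map fun p => (ofLex p).2)) s
      fun t ht => altLabels_of_sorted (hsort.sublist ht),
    coboundary_map, coboundary_altFrom, ← altFrom_map_not]
  simp [flipLabel, Function.comp_def]

/-- Neighbours in the sorted list differ in sign, hence, with no opposite labels, in absolute value.
The absolute values are thus strictly increasing and below `m`. -/
theorem length_le_of_altLabels_ne_zero {l : List (ℕ ×ₗ Bool)} {m : ℕ} (h : NoOpposite l)
    (hm : ∀ p ∈ l, (ofLex p).1 < m) (hl : altLabels l ≠ 0) : l.length ≤ m := by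
  set s := l.insertionSort (· ≤ ·) with hs
  have hp : s.Perm l := l.perm_insertionSort _
  have hsort : s.Pairwise (· ≤ ·) := l.pairwise_insertionSort _
  have hc : s.IsChain fun p q => (ofLex p).2 ≠ (ofLex q).2 :=
    List.isChain_map _ |>.1 (altFrom_ne_zero hl)
  have hlt : (s.map fun p => (ofLex p).1).IsChain (· < ·) := by
    rw [List.isChain_map]
    rw [List.isChain_iff_getElem] at hc ⊢
    intro i hi
    have h1 := hc i hi
    have h2 : s[i] ≤ s[i + 1] := List.pairwise_iff_getElem.1 hsort i (i + 1) _ _ (by omega)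
    rw [Prod.Lex.le_iff] at h2
    rcases h2 with h2 | ⟨h2, -⟩
    · exact h2
    · exact absurd (h _ (hp.subset (List.getElem_mem _)) _ (hp.subset (List.getElem_mem _)) h2) h1
  have hnd : (s.map fun p => (ofLex p).1).Nodup :=
    (List.isChain_iff_pairwise.1 hlt).imp fun hab => hab.ne
  have := (hnd.subperm (l₂ := List.range m) (by
    intro a ha
    obtain ⟨p, hps, rfl⟩ := List.mem_map.1 ha
    exact List.mem_range.2 (hm p (hp.subset hps)))).length_le
  simpa [hp.length_eq] using this

/-- The octahedral Tucker lemma. -/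
theorem octahedral_tucker {d m : ℕ} (hd : 0 < d) (lab : (ℕ → SignType) → ℕ)
    (sg : (ℕ → SignType) → Bool)
    (hlab : ∀ x, x ≠ 0 → (∀ j, d ≤ j → x j = 0) → lab (-x) = lab x)
    (hsg : ∀ x, x ≠ 0 → (∀ j, d ≤ j → x j = 0) → sg (-x) = !sg x)
    (hm : ∀ x, x ≠ 0 → (∀ j, d ≤ j → x j = 0) → lab x < m)
    (hedge : ∀ x y, x ≠ 0 → (∀ j, d ≤ j → y j = 0) → SignExtends x y → lab x = lab y →
      sg x = sg y) : d ≤ m := by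
  set key : (ℕ → SignType) → ℕ ×ₗ Bool := fun x => toLex (lab x, sg x) with hkey
  have hflip : ∀ i < d, ∀ l, IsSignChain (i + 1) l →
      (l.map Neg.neg).map key = (l.map key).map flipLabel := by
    intro i hi l hl
    simp only [List.map_map]
    refine List.map_congr_left fun x hx => ?_
    have h0 := hl.ne_zero x hx
    have h1 : ∀ j, d ≤ j → x j = 0 := fun j hj => hl.eq_zero_of_le x hx j (by omega)
    simp [hkey, flipLabel, hlab x h0 h1, hsg x h0 h1]
  have hopp : ∀ i < d, ∀ l, IsSignChain (i + 1) l → NoOpposite (l.map key) := by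
    intro i hi l hl
    have hp : l.Pairwise fun x y => lab x = lab y → sg x = sg y :=
      hl.pairwise.imp_of_mem fun {x y} hx hy hxy => hedge x y (hl.ne_zero x hx)
        (fun j hj => hl.eq_zero_of_le y hy j (by omega)) hxy
    have : Std.Symm fun x y => lab x = lab y → sg x = sg y := ⟨fun x y h e => (h e.symm).symm⟩
    have := hp.forall_of_forall fun _ _ _ => rfl
    intro p hp q hq
    obtain ⟨x, hx, rfl⟩ := List.mem_map.1 hp
    obtain ⟨y, hy, rfl⟩ := List.mem_map.1 hq
    exact this hx hy
  -- The number of alternating simplices on the sphere, counted by their starting sign `true`, is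
  -- odd in every dimension: summing the coboundary of `altLabels` over the next hemisphere gives
  -- the count in both dimensions.
  have hsum : ∀ i < d, hemisphere i (fun l => altLabels (l.map key)) +
      hemisphere i (fun l => altLabels ((l.map Neg.neg).map key)) = 1 := by
    intro i
    induction i with
    | zero =>
      intro _
      have h0 := hsg (Function.update 0 0 1) (update_one_ne_zero 0 0) fun j hj => by
        rw [Function.update_of_ne (by omega)]; rfl
      simp only [hemisphere, List.map_cons, List.map_nil, hkey, altLabels,
        List.insertionSort_cons, List.insertionSort_nil, List.orderedInsert_nil, ofLex_toLex, h0]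
      cases sg (Function.update 0 0 1) <;> simp [altFrom]
    | succ i ih =>
      intro hi
      rw [← hemisphere_add, ← ih (by omega), ← hemisphere_succ_coboundary]
      refine hemisphere_congr _ _ _ fun l hl => ?_
      rw [coboundary_map, coboundary_altLabels (hopp (i + 1) hi l hl), hflip (i + 1) hi l hl]
  have hd1 : d - 1 < d := by omega
  have hex : ∃ l, IsSignChain d l ∧ altLabels (l.map key) ≠ 0 := by
    by_contra! hne
    have h := hsum (d - 1) hd1
    have hdd : d - 1 + 1 = d := by omega
    have hz : hemisphere (d - 1) (fun _ => 0) = 0 := by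
      have := hemisphere_add (d - 1) (fun _ => 0) (fun _ => 0)
      simpa using this
    rw [hemisphere_congr (d - 1) _ (fun _ => 0) fun l hl => hne l (hdd ▸ hl),
      hemisphere_congr (d - 1) _ (fun _ => 0) fun l hl => hne _ (hdd ▸ hl).neg, hz] at h
    simp at h
  obtain ⟨l, hl, hne⟩ := hex
  have hl' : IsSignChain (d - 1 + 1) l := by rwa [Nat.sub_add_cancel hd]
  have := length_le_of_altLabels_ne_zero (hopp (d - 1) hd1 l hl') (m := m) (by
    intro p hp
    obtain ⟨x, hx, rfl⟩ := List.mem_map.1 hp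
    exact hm x (hl.ne_zero x hx) (hl.eq_zero_of_le x hx)) hne
  simpa [hl.length_eq] using this

/-! ### Monochromatic far pairs in the cube -/

/-- The subsets of `range d` whose indicator is compatible with the sign vector `x`. -/
def Completes (d : ℕ) (x : ℕ → SignType) (P : Finset ℕ) : Prop :=
  P ⊆ Finset.range d ∧ ∀ j < d, (x j = 1 → j ∈ P) ∧ (x j = -1 → j ∉ P)

theorem exists_completes (d : ℕ) (x : ℕ → SignType) : ∃ P, Completes d x P := by
  refine ⟨(Finset.range d).filter (x · = 1), Finset.filter_subset _ _, fun j hj => ⟨?_, ?_⟩⟩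
  · intro h; simp [h, hj]
  · intro h; simp [h]

theorem Completes.of_extends {d : ℕ} {x y : ℕ → SignType} (h : SignExtends x y) {P : Finset ℕ}
    (hP : Completes d y P) : Completes d x P := by
  refine ⟨hP.1, fun j hj => ⟨fun h1 => (hP.2 j hj).1 ?_, fun h1 => (hP.2 j hj).2 ?_⟩⟩
  · rw [h j (by simp [h1]), h1]
  · rw [h j (by simp [h1]), h1]

theorem SignExtends.neg {x y : ℕ → SignType} (h : SignExtends x y) : SignExtends (-x) (-y) :=
  fun j hj => by
    have : x j ≠ 0 := fun h0 => hj (by simp [h0])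
    simp [h j this]

theorem Completes.support_subset_symmDiff {d : ℕ} {x : ℕ → SignType} {P Q : Finset ℕ}
    (hP : Completes d x P) (hQ : Completes d (-x) Q) :
    (Finset.range d).filter (x · ≠ 0) ⊆ symmDiff P Q := by
  intro j hj
  simp only [Finset.mem_filter, Finset.mem_range] at hj
  have h1 := hP.2 j hj.1
  have h2 := hQ.2 j hj.1
  rw [Finset.mem_symmDiff]
  rcases h : x j with _ | _ | _
  · exact absurd h hj.2
  · exact Or.inr ⟨h2.1 (by simp [h]), h1.2 h⟩
  · exact Or.inl ⟨h1.1 h, h2.2 (by simp [h])⟩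

open Classical in
/-- Every colouring of the subsets of `range d` with `k` colours has two sets of the same colour
which differ in at least `d - k` places. -/
theorem exists_monochromatic_far_pair (k d : ℕ) (c : Finset ℕ → ℕ) (hc : ∀ P, c P < k) :
    ∃ P Q, P ⊆ Finset.range d ∧ Q ⊆ Finset.range d ∧ c P = c Q ∧ d ≤ (symmDiff P Q).card + k := by
  by_cases hdk : d ≤ k
  · exact ⟨∅, ∅, by simp, by simp, rfl, by simpa using hdk⟩
  by_contra! H
  -- Small supports use the `s` labels below `s`, and large ones the `k` labels given by colours.
  -- This makes `d - 1` labels, one too few for the Tucker lemma.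
  set s := d - k - 1 with hs
  set supp : (ℕ → SignType) → Finset ℕ := fun x => (Finset.range d).filter (x · ≠ 0) with hsupp
  set col : (ℕ → SignType) → Set ℕ := fun x => {i | ∃ P, Completes d x P ∧ c P = i} with hcol
  set minc : (ℕ → SignType) → ℕ := fun x => sInf (col x ∪ col (-x)) with hminc
  set lab : (ℕ → SignType) → ℕ := fun x =>
    if (supp x).card ≤ s then (supp x).card - 1 else s + minc x with hlab
  set sg : (ℕ → SignType) → Bool := fun x =>
    if (supp x).card ≤ s then decide (x (sInf {j | x j ≠ 0}) = 1) else decide (minc x ∈ col x)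
    with hsg
  have hne : ∀ x, (col x).Nonempty := fun x => by
    obtain ⟨P, hP⟩ := exists_completes d x
    exact ⟨c P, P, hP, rfl⟩
  have hmem : ∀ x, minc x ∈ col x ∪ col (-x) := fun x => Nat.sInf_mem ((hne x).inl)
  -- Completions of `x` and `-x` differ on the whole support of `x`, which has at least `d - k`
  -- elements, so by `H` they share no colour.
  have hdisj : ∀ x, s < (supp x).card → ∀ i ∈ col x, i ∉ col (-x) := by
    rintro x hx i ⟨P, hP, rfl⟩ ⟨Q, hQ, hPQ⟩
    have h1 := H P Q hP.1 hQ.1 hPQ.symm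
    have h2 := Finset.card_le_card (hP.support_subset_symmDiff hQ)
    change (supp x).card ≤ _ at h2
    omega
  have hcolext : ∀ x y, SignExtends x y → col y ⊆ col x := by
    rintro x y hxy i ⟨P, hP, rfl⟩
    exact ⟨P, hP.of_extends hxy, rfl⟩
  have hsneg : ∀ x, supp (-x) = supp x := fun x => by simp [hsupp]
  have hmneg : ∀ x, minc (-x) = minc x := fun x => by simp [hminc, Set.union_comm]
  have hpos : ∀ x, x ≠ 0 → (∀ j, d ≤ j → x j = 0) → 0 < (supp x).card := by
    intro x hx hxd
    obtain ⟨j, hj⟩ := Function.ne_iff.1 hx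
    refine Finset.card_pos.2 ⟨j, ?_⟩
    simp only [hsupp, Finset.mem_filter, Finset.mem_range]
    exact ⟨by by_contra hd; exact hj (hxd j (by omega)), hj⟩
  have := octahedral_tucker (d := d) (m := s + k) (by omega) lab sg ?_ ?_ ?_ ?_
  · omega
  · intro x _ _
    simp only [hlab, hsneg, hmneg]
  · intro x hx hxd
    simp only [hsg, hsneg, hmneg]
    split_ifs with h
    · have h1 : x (sInf {j | x j ≠ 0}) ≠ 0 := Nat.sInf_mem (Function.ne_iff.1 hx)
      have h2 : {j | (-x) j ≠ 0} = {j | x j ≠ 0} := by ext; simp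
      rw [h2, Pi.neg_apply]
      revert h1
      cases x (sInf {j | x j ≠ 0}) <;> decide
    · have h1 := hmem x
      have h2 := hdisj x (not_le.1 h) (minc x)
      by_cases h3 : minc x ∈ col x
      · simp [h3, h2 h3]
      · simp [h3, h1.resolve_left h3]
  · intro x hx hxd
    have := hpos x hx hxd
    simp only [hlab]
    split_ifs with h
    · omega
    · have : minc x < k := by
        rcases hmem x with ⟨P, -, hP⟩ | ⟨P, -, hP⟩ <;> rw [← hP] <;> exact hc P
      omega
  · intro x y hx hyd hxy hl
    have hxd : ∀ j, d ≤ j → x j = 0 := fun j hj => by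
      by_contra h
      exact h ((hxy j h).symm.trans (hyd j hj))
    have hy : y ≠ 0 := by
      obtain ⟨j, hj⟩ := Function.ne_iff.1 hx
      exact Function.ne_iff.2 ⟨j, by rw [hxy j hj]; exact hj⟩
    have hx0 := hpos x hx hxd
    have hy0 := hpos y hy hyd
    simp only [hlab] at hl
    by_cases h1 : (supp x).card ≤ s <;> by_cases h2 : (supp y).card ≤ s
    · rw [if_pos h1, if_pos h2] at hl
      have hsub : supp x ⊆ supp y := fun j hj => by
        simp only [hsupp, Finset.mem_filter] at hj ⊢
        exact ⟨hj.1, by rw [hxy j hj.2]; exact hj.2⟩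
      have heq := Finset.eq_of_subset_of_card_le hsub (by omega)
      have : x = y := by
        funext j
        by_cases hj : x j = 0
        · by_contra hne
          have hjy : y j ≠ 0 := fun h => hne (hj.trans h.symm)
          have : j ∈ supp x := by
            rw [heq]
            simp only [hsupp, Finset.mem_filter, Finset.mem_range]
            exact ⟨by by_contra hd; exact hjy (hyd j (by omega)), hjy⟩
          exact (Finset.mem_filter.1 this).2 hj
        · exact (hxy j hj).symm
      rw [this]
    · rw [if_pos h1, if_neg h2] at hl; omega
    · rw [if_neg h1, if_pos h2] at hl; omega
    · rw [if_neg h1, if_neg h2] at hl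
      have hm : minc x = minc y := by omega
      simp only [hsg, if_neg h1, if_neg h2, hm]
      -- If the common least colour were seen by `x` and by `-y`, it would also be seen by `-x`,
      -- against `hdisj`.
      refine decide_eq_decide.2 ⟨fun h => ?_, fun h => hcolext x y hxy h⟩
      refine (hmem y).resolve_right fun h' => ?_
      exact hdisj x (not_le.1 h1) _ h (hcolext _ _ hxy.neg h')

/-! ### Size of the middle layers -/

/-- The induction step reduces to `(2n+1)(2n+3) ≤ 4(n+1)²`. The bound serves to make the central
binomial coefficient negligible against `4 ^ n`. -/
theorem centralBinom_sq_mul_le (n : ℕ) : n.centralBinom ^ 2 * (2 * n + 1) ≤ 16 ^ n := by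
  induction n with
  | zero => simp
  | succ n ih =>
    have h := Nat.succ_mul_centralBinom_succ n
    have h2 : (n + 1) ^ 2 * ((n + 1).centralBinom ^ 2 * (2 * (n + 1) + 1)) ≤
        (n + 1) ^ 2 * 16 ^ (n + 1) := by
      calc (n + 1) ^ 2 * ((n + 1).centralBinom ^ 2 * (2 * (n + 1) + 1))
          = ((n + 1) * (n + 1).centralBinom) ^ 2 * (2 * n + 3) := by ring
        _ = (n.centralBinom ^ 2 * (2 * n + 1)) * (4 * (2 * n + 1) * (2 * n + 3)) := by
          rw [h]; ring
        _ ≤ 16 ^ n * (4 * (2 * n + 1) * (2 * n + 3)) := Nat.mul_le_mul_right _ ih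
        _ ≤ 16 ^ n * (16 * (n + 1) ^ 2) := Nat.mul_le_mul_left _ (by nlinarith)
        _ = (n + 1) ^ 2 * 16 ^ (n + 1) := by ring
    exact Nat.le_of_mul_le_mul_left h2 (by positivity)

theorem exists_mul_centralBinom_le (k : ℕ) {η : ℝ} (hη : 0 < η) :
    ∃ N : ℕ, k < N ∧ (2 * k + 1 : ℝ) * N.centralBinom ≤ η * 4 ^ N := by
  obtain ⟨n, hn⟩ := exists_nat_gt (((2 * k + 1 : ℝ) / η) ^ 2)
  refine ⟨n + k + 1, by omega, ?_⟩
  set N := n + k + 1 with hN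
  have h1 : (N.centralBinom : ℝ) ^ 2 * (2 * N + 1) ≤ (4 ^ N) ^ 2 := by
    have := centralBinom_sq_mul_le N
    have h16 : ((4 : ℝ) ^ N) ^ 2 = 16 ^ N := by rw [← pow_mul, mul_comm, pow_mul]; norm_num
    rw [h16]
    exact_mod_cast this
  have h2 : (2 * k + 1 : ℝ) ^ 2 ≤ η ^ 2 * (2 * N + 1) := by
    rw [div_pow, div_lt_iff₀ (by positivity)] at hn
    have : (n : ℝ) ≤ 2 * N + 1 := by rw [hN]; push_cast; linarith
    nlinarith [mul_le_mul_of_nonneg_right this (sq_nonneg η)]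
  refine le_of_sq_le_sq ?_ (by positivity)
  calc ((2 * k + 1 : ℝ) * N.centralBinom) ^ 2
      = (2 * k + 1 : ℝ) ^ 2 * (N.centralBinom : ℝ) ^ 2 := by ring
    _ ≤ η ^ 2 * (2 * N + 1) * (N.centralBinom : ℝ) ^ 2 := by gcongr
    _ = η ^ 2 * ((N.centralBinom : ℝ) ^ 2 * (2 * N + 1)) := by ring
    _ ≤ η ^ 2 * (4 ^ N) ^ 2 := by gcongr
    _ = (η * 4 ^ N) ^ 2 := by ring

theorem card_powerset_filter_card_inter {I J : Finset ℕ} (hIJ : I ⊆ J) (w : ℕ) :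
    (J.powerset.filter fun P => (P ∩ I).card = w).card =
      I.card.choose w * 2 ^ (J.card - I.card) := by
  rw [← Finset.card_powersetCard, ← Finset.card_sdiff_of_subset hIJ, ← Finset.card_powerset,
    ← Finset.card_product]
  refine Finset.card_nbij' (fun P => (P ∩ I, P \ I)) (fun p => p.1 ∪ p.2) ?_ ?_ ?_ ?_
  · intro P hP
    simp only [Finset.coe_filter, Finset.mem_powerset, Set.mem_ofPred_eq] at hP
    simp only [Finset.coe_product, Set.mem_prod, Finset.mem_coe, Finset.mem_powersetCard,
      Finset.mem_powerset]
    exact ⟨⟨Finset.inter_subset_right, hP.2⟩, Finset.sdiff_subset_sdiff hP.1 subset_rfl⟩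
  · rintro ⟨Q, R⟩ h
    simp only [Finset.coe_product, Set.mem_prod, Finset.mem_coe, Finset.mem_powersetCard,
      Finset.mem_powerset] at h
    simp only [Finset.coe_filter, Finset.mem_powerset, Set.mem_ofPred_eq]
    refine ⟨Finset.union_subset (h.1.1.trans hIJ) (h.2.trans Finset.sdiff_subset), ?_⟩
    rw [← h.1.2]
    congr 1
    ext j
    have h1 := @h.1.1 j
    have h2 := @h.2 j
    simp only [Finset.mem_sdiff, Finset.mem_inter, Finset.mem_union] at h1 h2 ⊢
    tauto
  · intro P _
    ext j
    simp only [Finset.mem_sdiff, Finset.mem_inter, Finset.mem_union]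
    tauto
  · rintro ⟨Q, R⟩ h
    simp only [Finset.coe_product, Set.mem_prod, Finset.mem_coe, Finset.mem_powersetCard,
      Finset.mem_powerset] at h
    refine Prod.ext ?_ ?_ <;> ext j <;>
    · have h1 := @h.1.1 j
      have h2 := @h.2 j
      simp only [Finset.mem_sdiff, Finset.mem_inter, Finset.mem_union] at h1 h2 ⊢
      tauto

theorem card_middle_le {I : Finset ℕ} {n N : ℕ} (k : ℕ) (hI : I ⊆ Finset.range n)
    (hN : I.card = 2 * N) :
    ((Finset.range n).powerset.filter fun P => N ≤ (P ∩ I).card + k ∧ (P ∩ I).card ≤ N + k).card ≤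
      (2 * k + 1) * (N.centralBinom * 2 ^ (n - 2 * N)) := by
  have hsub : ((Finset.range n).powerset.filter
      fun P => N ≤ (P ∩ I).card + k ∧ (P ∩ I).card ≤ N + k) ⊆
      (Finset.Icc (N - k) (N + k)).biUnion fun w =>
        (Finset.range n).powerset.filter fun P => (P ∩ I).card = w := by
    intro P hP
    simp only [Finset.mem_filter] at hP
    simp only [Finset.mem_biUnion, Finset.mem_filter, Finset.mem_Icc]
    exact ⟨_, by omega, hP.1, rfl⟩
  refine (Finset.card_le_card hsub).trans (Finset.card_biUnion_le.trans ?_)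
  refine (Finset.sum_le_card_nsmul _ _ (N.centralBinom * 2 ^ (n - 2 * N)) fun w _ => ?_).trans ?_
  · rw [card_powerset_filter_card_inter hI, hN, Finset.card_range]
    exact Nat.mul_le_mul_right _ (Nat.choose_le_centralBinom w N)
  · rw [smul_eq_mul, Nat.card_Icc]
    exact Nat.mul_le_mul_right _ (by omega)

/-! ### Stages and the twisting construction -/

open Classical in
/-- A family of finite sets that depends only on the first `m` coordinates, is disjoint from its
translate by `{0}`, and has density at least `δ`. -/
structure IsStage (m : ℕ) (A : Set (Finset ℕ)) (δ : ℝ) : Prop where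
  pos : 0 < m
  cylinder : ∀ P u, Disjoint u (Finset.range m) → P ∈ A → symmDiff P u ∈ A
  avoids : ∀ P ∈ A, symmDiff P {0} ∉ A
  density : ∀ n, m ≤ n → δ * 2 ^ n ≤ ((Finset.range n).powerset.filter (· ∈ A)).card

theorem symmDiff_inter_of_disjoint {t I : Finset ℕ} (h : Disjoint t I) (P : Finset ℕ) :
    symmDiff P t ∩ I = P ∩ I := by
  ext j
  have : j ∈ t → j ∉ I := fun h1 => Finset.disjoint_left.1 h h1
  simp only [Finset.mem_inter, Finset.mem_symmDiff]
  tauto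

/-- Keep `A` where few elements of `I` are used, translate it by `t` where many are used, and drop
the middle layers. -/
def twist (I : Finset ℕ) (N k : ℕ) (t : Finset ℕ) (A : Set (Finset ℕ)) : Set (Finset ℕ) :=
  {P | ((P ∩ I).card + k < N ∧ P ∈ A) ∨ (N + k < (P ∩ I).card ∧ symmDiff P t ∈ A)}

theorem twist_avoids_of_disjoint {I : Finset ℕ} {N k : ℕ} {t s : Finset ℕ}
    {A : Set (Finset ℕ)} (hs : Disjoint s I) (h : ∀ P ∈ A, symmDiff P s ∉ A) :
    ∀ P ∈ twist I N k t A, symmDiff P s ∉ twist I N k t A := by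
  intro P hP hP'
  simp only [twist, Set.mem_ofPred_eq, symmDiff_inter_of_disjoint hs] at hP hP'
  rcases hP with ⟨h1, h2⟩ | ⟨h1, h2⟩ <;> rcases hP' with ⟨h3, h4⟩ | ⟨h3, h4⟩
  · exact h P h2 h4
  · omega
  · omega
  · refine h _ h2 ?_
    rwa [symmDiff_right_comm]

/-- Translation by `u` flips all but at most `k` elements of `I`, so it cannot join two low layers
or two high ones. Between a low and a high layer, the shift by `symmDiff {0} g` cancels `g` and
leaves translation by `u` and `{0}`; `A` does not see `u`, and it avoids `{0}`. -/
theorem twist_avoids {I : Finset ℕ} {m N k : ℕ} {g u : Finset ℕ} {A : Set (Finset ℕ)} {δ : ℝ}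
    (hA : IsStage m A δ) (hI : I.card = 2 * N) (hIm : Disjoint I (Finset.range m))
    (hg : Disjoint g I) (hu : u ⊆ I) (huk : 2 * N ≤ u.card + k) :
    ∀ P ∈ twist I N k (symmDiff {0} g) A,
      symmDiff P (symmDiff u g) ∉ twist I N k (symmDiff {0} g) A := by
  intro P hP hP'
  have hum : Disjoint u (Finset.range m) := hIm.mono_left hu
  set Q := symmDiff P (symmDiff u g) with hQ
  have hj : ∀ j ∈ u, j ∈ I ∧ (j ∈ Q ↔ j ∉ P) := fun j hj => by
    have h1 := hu hj
    have h2 : j ∉ g := fun h => Finset.disjoint_left.1 hg h h1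
    refine ⟨h1, ?_⟩
    simp only [hQ, Finset.mem_symmDiff]
    tauto
  rcases hP with ⟨h1, h2⟩ | ⟨h1, h2⟩ <;> rcases hP' with ⟨h3, h4⟩ | ⟨h3, h4⟩
  · have hsub : u ⊆ (P ∩ I) ∪ (Q ∩ I) := fun j hju => by
      have := hj j hju
      simp only [Finset.mem_union, Finset.mem_inter]
      tauto
    have := (Finset.card_le_card hsub).trans (Finset.card_union_le _ _)
    omega
  · have e : symmDiff (symmDiff P u) {0} = symmDiff Q (symmDiff {0} g) := by
      rw [hQ]
      generalize ({0} : Finset ℕ) = z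
      ext j
      by_cases a1 : j ∈ P <;> by_cases a2 : j ∈ u <;> by_cases a3 : j ∈ g <;>
        by_cases a4 : j ∈ z <;> simp [Finset.mem_symmDiff, a1, a2, a3, a4]
    exact hA.avoids _ (hA.cylinder P u hum h2) (e ▸ h4)
  · have e : symmDiff (symmDiff (symmDiff P (symmDiff {0} g)) u) {0} = Q := by
      rw [hQ]
      generalize ({0} : Finset ℕ) = z
      ext j
      by_cases a1 : j ∈ P <;> by_cases a2 : j ∈ u <;> by_cases a3 : j ∈ g <;>
        by_cases a4 : j ∈ z <;> simp [Finset.mem_symmDiff, a1, a2, a3, a4]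
    exact hA.avoids _ (hA.cylinder _ u hum h2) (e ▸ h4)
  · have hsub : u ⊆ (I \ P) ∪ (I \ Q) := fun j hju => by
      have := hj j hju
      simp only [Finset.mem_union, Finset.mem_sdiff]
      tauto
    have h5 := (Finset.card_le_card hsub).trans (Finset.card_union_le _ _)
    have h6 := Finset.card_sdiff_add_card_inter I P
    have h7 := Finset.card_sdiff_add_card_inter I Q
    rw [Finset.inter_comm] at h6 h7
    omega

open Classical in
theorem card_filter_le_card_twist_add {I J t : Finset ℕ} (N k : ℕ) (A : Set (Finset ℕ))
    (ht : t ⊆ J) (htI : Disjoint t I) :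
    (J.powerset.filter (· ∈ A)).card ≤ (J.powerset.filter (· ∈ twist I N k t A)).card +
      (J.powerset.filter fun P => N ≤ (P ∩ I).card + k ∧ (P ∩ I).card ≤ N + k).card := by
  set M : Finset ℕ → Prop := fun P => N ≤ (P ∩ I).card + k ∧ (P ∩ I).card ≤ N + k with hM
  rw [← Finset.card_filter_add_card_filter_not (s := J.powerset.filter (· ∈ A)) M, add_comm]
  refine Nat.add_le_add ?_ ?_
  · refine Finset.card_le_card_of_injOn
      (fun P => if (P ∩ I).card + k < N then P else symmDiff P t) ?_ ?_
    · intro P hP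
      simp only [Finset.coe_filter, Finset.mem_filter, Finset.mem_powerset,
        Set.mem_ofPred_eq, hM, not_and, not_le] at hP ⊢
      obtain ⟨⟨h1, h2⟩, h3⟩ := hP
      split_ifs with h
      · exact ⟨h1, Or.inl ⟨h, h2⟩⟩
      · refine ⟨symmDiff_le_sup.trans (Finset.union_subset h1 ht), Or.inr ?_⟩
        rw [symmDiff_inter_of_disjoint htI, symmDiff_symmDiff_cancel_right]
        exact ⟨h3 (by omega), h2⟩
    · intro P _ Q _ hPQ
      -- Both branches preserve the trace on `I`, so the image determines which branch was taken.
      have key : ∀ R, (if (R ∩ I).card + k < N then R else symmDiff R t) ∩ I = R ∩ I := by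
        intro R
        split_ifs
        · rfl
        · exact symmDiff_inter_of_disjoint htI R
      have h1 : P ∩ I = Q ∩ I := by
        rw [← key P, ← key Q]
        exact congrArg (· ∩ I) hPQ
      simp only [h1] at hPQ
      split_ifs at hPQ
      · exact hPQ
      · exact symmDiff_left_injective t hPQ
  · exact Finset.card_le_card (Finset.filter_subset_filter _ (Finset.filter_subset _ _))

theorem IsStage.exists_next {m : ℕ} {A : Set (Finset ℕ)} {δ η : ℝ} (hA : IsStage m A δ)
    (hη : 0 < η) (g : Finset ℕ) (k : ℕ) :
    ∃ m' A', IsStage m' A' (δ - η) ∧ m < m' ∧ (∀ P ⊆ Finset.range m, P ∈ A' ↔ P ∈ A) ∧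
      (∀ s ⊆ Finset.range m, (∀ P ∈ A, symmDiff P s ∉ A) → ∀ P ∈ A', symmDiff P s ∉ A') ∧
      ∀ c : Finset ℕ → ℕ, (∀ P, c P < k) → ∃ P Q, c P = c Q ∧
        symmDiff (symmDiff P Q) g ⊆ Finset.range m' ∧
        ∀ R ∈ A', symmDiff R (symmDiff (symmDiff P Q) g) ∉ A' := by
  classical
  -- The middle layers then cost at most `η`. The bound `k < N` puts sets disjoint from `I` in the
  -- low layers, where `A` is unchanged.
  obtain ⟨N, hkN, hN⟩ := exists_mul_centralBinom_le k hη
  obtain ⟨b, hb⟩ : ∃ b, g ⊆ Finset.range b := g.exists_nat_subset_range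
  -- Starting the block beyond both `m` and `g` makes it invisible to `A` and disjoint from `g`.
  set a := max m b with ha
  have hma : m ≤ a := le_max_left _ _
  have hga : g ⊆ Finset.range a := hb.trans (Finset.range_subset_range.2 (le_max_right _ _))
  set I := Finset.Ico a (a + 2 * N) with hI
  have hIcard : I.card = 2 * N := by simp [hI]
  have hIa : ∀ s ⊆ Finset.range a, Disjoint s I := fun s hs => by
    rw [Finset.disjoint_left]
    intro j hj hj'
    have := Finset.mem_range.1 (hs hj)
    simp only [hI, Finset.mem_Ico] at hj'
    omega
  have hmsub : Finset.range m ⊆ Finset.range a := Finset.range_subset_range.2 hma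
  have h0 : ({0} : Finset ℕ) ⊆ Finset.range m := by simpa using hA.pos
  set t := symmDiff {0} g with ht
  have hta : t ⊆ Finset.range a :=
    symmDiff_le_sup.trans (Finset.union_subset (h0.trans hmsub) hga)
  have htI := hIa t hta
  have hpres : ∀ s ⊆ Finset.range m, (∀ P ∈ A, symmDiff P s ∉ A) →
      ∀ P ∈ twist I N k t A, symmDiff P s ∉ twist I N k t A := fun s hs h =>
    twist_avoids_of_disjoint (hIa s (hs.trans hmsub)) h
  refine ⟨a + 2 * N, twist I N k t A, ⟨by omega, ?_, hpres _ h0 hA.avoids, ?_⟩, by omega, ?_, hpres,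
    ?_⟩
  · intro P u hu hP
    have huI : Disjoint u I := by
      refine hu.mono_right fun j hj => ?_
      simp only [hI, Finset.mem_Ico] at hj
      exact Finset.mem_range.2 hj.2
    have hum : Disjoint u (Finset.range m) :=
      hu.mono_right (Finset.range_subset_range.2 (by omega))
    simp only [twist, Set.mem_ofPred_eq, symmDiff_inter_of_disjoint huI] at hP ⊢
    refine hP.imp (fun h => ⟨h.1, hA.cylinder P u hum h.2⟩) fun h => ⟨h.1, ?_⟩
    rw [symmDiff_right_comm]
    exact hA.cylinder _ u hum h.2
  · intro n hn
    have hIn : I ⊆ Finset.range n := fun j hj => by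
      simp only [hI, Finset.mem_Ico] at hj
      exact Finset.mem_range.2 (by omega)
    have htn : t ⊆ Finset.range n := hta.trans (Finset.range_subset_range.2 (by omega))
    have h1 := hA.density n (by omega)
    have h2 := card_filter_le_card_twist_add N k A htn htI
    have h3 := h2.trans (Nat.add_le_add_left (card_middle_le k hIn hIcard) _)
    have h4 : ((2 * k + 1 : ℝ) * (N.centralBinom * 2 ^ (n - 2 * N))) ≤ η * 2 ^ n := by
      have h5 : (2 : ℝ) ^ n = 4 ^ N * 2 ^ (n - 2 * N) := by
        rw [show (4 : ℝ) = 2 ^ 2 by norm_num, ← pow_mul, ← pow_add]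
        congr 1; omega
      rw [h5, ← mul_assoc, ← mul_assoc]
      gcongr
    have h3' : (((Finset.range n).powerset.filter (· ∈ A)).card : ℝ) ≤
        ((Finset.range n).powerset.filter (· ∈ twist I N k t A)).card +
        (2 * k + 1 : ℝ) * (N.centralBinom * 2 ^ (n - 2 * N)) := by exact_mod_cast h3
    linarith
  · intro P hP
    have : P ∩ I = ∅ := Finset.disjoint_iff_inter_eq_empty.1 (hIa P (hP.trans hmsub))
    simp only [twist, Set.mem_ofPred_eq, this, Finset.card_empty]
    constructor
    · rintro (h | h)
      · exact h.2
      · omega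
    · exact fun h => Or.inl ⟨by omega, h⟩
  · intro c hc
    obtain ⟨P, Q, hP, hQ, hPQ, hcard⟩ := exists_monochromatic_far_pair k (2 * N)
      (fun P => c (P.image (a + ·))) fun P => hc _
    have hu : symmDiff (P.image (a + ·)) (Q.image (a + ·)) = (symmDiff P Q).image (a + ·) :=
      (Finset.image_symmDiff _ _ (add_right_injective a)).symm
    have huI : (symmDiff P Q).image (a + ·) ⊆ I := by
      intro j hj
      obtain ⟨i, hi, rfl⟩ := Finset.mem_image.1 hj
      have := (symmDiff_le_sup.trans (Finset.union_subset hP hQ)) hi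
      have := Finset.mem_range.1 this
      simp only [hI, Finset.mem_Ico]
      omega
    refine ⟨P.image (a + ·), Q.image (a + ·), hPQ, ?_, ?_⟩
    · rw [hu]
      refine symmDiff_le_sup.trans (Finset.union_subset (fun j hj => ?_)
        (hga.trans (Finset.range_subset_range.2 (by omega))))
      have := huI hj
      simp only [hI, Finset.mem_Ico] at this
      exact Finset.mem_range.2 this.2
    · rw [hu]
      refine twist_avoids hA hIcard (hIa _ hmsub).symm (hIa g hga) huI ?_
      rwa [Finset.card_image_of_injective _ (add_right_injective a)]

/-! ### The initial stage and the limit family -/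

theorem isStage_zero_notMem : IsStage 1 {P | 0 ∉ P} (1 / 2) := by
  classical
  refine ⟨one_pos, ?_, ?_, ?_⟩
  · intro P u hu hP
    have : 0 ∉ u := fun h => Finset.disjoint_left.1 hu h (by simp)
    simp only [Set.mem_ofPred_eq, Finset.mem_symmDiff] at hP ⊢
    tauto
  · intro P hP
    simp only [Set.mem_ofPred_eq, Finset.mem_symmDiff, Finset.mem_singleton] at hP ⊢
    tauto
  · intro n hn
    have h : ((Finset.range n).erase 0).powerset ⊆
        (Finset.range n).powerset.filter (· ∈ {P : Finset ℕ | 0 ∉ P}) := by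
      intro P hP
      rw [Finset.mem_powerset, Finset.subset_erase] at hP
      simpa using hP
    have h1 := Finset.card_le_card h
    rw [Finset.card_powerset, Finset.card_erase_of_mem (by simp; omega), Finset.card_range] at h1
    have h2 : (1 / 2 : ℝ) * 2 ^ n = 2 ^ (n - 1) := by
      obtain ⟨n, rfl⟩ := Nat.exists_eq_add_of_le' hn
      rw [Nat.add_sub_cancel, pow_succ]; ring
    rw [h2]
    have h3 : (2 : ℝ) ^ (n - 1) ≤ ((Finset.range n).powerset.filter
        (· ∈ {P : Finset ℕ | 0 ∉ P})).card := by exact_mod_cast h1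
    convert h3

open Classical in
theorem exists_family_avoiding {ε : ℝ} (hε : 0 < ε) :
    ∃ (m : ℕ → ℕ) (A : Set (Finset ℕ)), StrictMono m ∧
      (∀ j, (1 / 2 - ε) * 2 ^ m j ≤ ((Finset.range (m j)).powerset.filter (· ∈ A)).card) ∧
      ∀ (k : ℕ) (g : Finset ℕ) (c : Finset ℕ → ℕ), (∀ P, c P < k) → ∃ P Q, c P = c Q ∧
        ∀ R ∈ A, symmDiff R (symmDiff (symmDiff P Q) g) ∉ A := by
  -- Stage `j + 1` deals with the translate and the number of colours listed in `e j`.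
  obtain ⟨e, he⟩ := exists_surjective_nat (Finset ℕ × ℕ)
  -- The step from `j` to `j + 1` may lose `ε / 2 ^ (j + 1)`, so the densities start at 1/2 and stay
  -- above `1 / 2 - ε`.
  set δ : ℕ → ℝ := fun j => 1 / 2 - ε + ε * (1 / 2) ^ j with hδ
  have hnext : ∀ (j : ℕ) (p : {p : ℕ × Set (Finset ℕ) // IsStage p.1 p.2 (δ j)}),
      ∃ q : {p : ℕ × Set (Finset ℕ) // IsStage p.1 p.2 (δ (j + 1))}, p.1.1 < q.1.1 ∧
      (∀ P ⊆ Finset.range p.1.1, P ∈ q.1.2 ↔ P ∈ p.1.2) ∧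
      (∀ s ⊆ Finset.range p.1.1, (∀ P ∈ p.1.2, symmDiff P s ∉ p.1.2) →
        ∀ P ∈ q.1.2, symmDiff P s ∉ q.1.2) ∧
      ∀ c : Finset ℕ → ℕ, (∀ P, c P < (e j).2) → ∃ P Q, c P = c Q ∧
        symmDiff (symmDiff P Q) (e j).1 ⊆ Finset.range q.1.1 ∧
        ∀ R ∈ q.1.2, symmDiff R (symmDiff (symmDiff P Q) (e j).1) ∉ q.1.2 := by
    rintro j ⟨⟨m, A⟩, hA⟩
    obtain ⟨m', A', h', h⟩ := hA.exists_next (η := ε * (1 / 2) ^ (j + 1)) (by positivity)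
      (e j).1 (e j).2
    refine ⟨⟨(m', A'), ?_⟩, h⟩
    convert h' using 1
    simp only [hδ, pow_succ]; ring
  choose nx hlt hcompat hpres hrec using hnext
  have hbase : IsStage 1 {P | 0 ∉ P} (δ 0) := by
    convert isStage_zero_notMem using 1
    simp [hδ]
  set σ : ∀ j, {p : ℕ × Set (Finset ℕ) // IsStage p.1 p.2 (δ j)} := fun j =>
    Nat.rec ⟨(1, {P | 0 ∉ P}), hbase⟩ (fun j p => nx j p) j with hσ
  have hσs : ∀ j, σ (j + 1) = nx j (σ j) := fun j => rfl
  set m : ℕ → ℕ := fun j => (σ j).1.1 with hm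
  set A : ℕ → Set (Finset ℕ) := fun j => (σ j).1.2 with hA
  have hmono : StrictMono m := strictMono_nat_of_lt_succ fun j => hlt j (σ j)
  have hstable : ∀ i j, i ≤ j → ∀ P ⊆ Finset.range (m i), P ∈ A j ↔ P ∈ A i := by
    intro i j hij P hP
    induction j, hij using Nat.le_induction with
    | base => rfl
    | succ j hij ih =>
      rw [← ih]
      exact hcompat j (σ j) P (hP.trans (Finset.range_subset_range.2 (hmono.monotone hij)))
  have havoid : ∀ i j, i ≤ j → ∀ s ⊆ Finset.range (m i), (∀ P ∈ A i, symmDiff P s ∉ A i) →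
      ∀ P ∈ A j, symmDiff P s ∉ A j := by
    intro i j hij s hs h
    induction j, hij using Nat.le_induction with
    | base => exact h
    | succ j hij ih =>
      exact hpres j (σ j) s (hs.trans (Finset.range_subset_range.2 (hmono.monotone hij))) ih
  -- Membership of a finite set is constant once `range (m j)` contains it, so the limit agrees with
  -- `A j` there. Differences once avoided stay avoided, since two elements of the limit lie
  -- together in some late stage.
  refine ⟨m, {P | ∀ᶠ j in atTop, P ∈ A j}, hmono, fun j => ?_, fun k g c hc => ?_⟩
  · have h1 := (σ j).2.density (m j) le_rfl
    have h2 : (Finset.range (m j)).powerset.filter (· ∈ {P | ∀ᶠ j in atTop, P ∈ A j}) =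
        (Finset.range (m j)).powerset.filter (· ∈ A j) := by
      refine Finset.filter_congr fun P hP => ?_
      rw [Finset.mem_powerset] at hP
      constructor
      · intro h
        obtain ⟨i, hi, hji⟩ := (h.and (eventually_ge_atTop j)).exists
        exact (hstable j i hji P hP).1 hi
      · intro h
        filter_upwards [eventually_ge_atTop j] with i hi
        exact (hstable j i hi P hP).2 h
    rw [h2]
    refine le_trans ?_ h1
    gcongr
    simp only [hδ]
    have : 0 < ε * (1 / 2) ^ j := by positivity
    linarith
  · obtain ⟨j, hj⟩ := he (g, k)
    obtain ⟨P, Q, hPQ, hsub, hav⟩ := hrec j (σ j) c (by simpa [hj] using hc)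
    rw [hj] at hsub hav
    refine ⟨P, Q, hPQ, fun R hR hR' => ?_⟩
    obtain ⟨i, ⟨h1, h2⟩, hji⟩ := ((hR.and hR').and (eventually_ge_atTop (j + 1))).exists
    exact havoid (j + 1) i hji _ hsub hav R h1 h2

/-! ### Transfer to `G2`, densities and piecewise syndetic sets -/

/-- Elements of `G2` correspond to their supports. -/
def supportEquiv : G2 ≃ Finset ℕ where
  toFun x := DFinsupp.support x
  invFun P := DFinsupp.mk P fun _ => 1
  left_inv x := by
    refine DFinsupp.ext fun i => ?_
    rw [DFinsupp.mk_apply]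
    split_ifs with h
    · have key : ∀ a : ZMod 2, a ≠ 0 → 1 = a := by decide
      exact key _ (DFinsupp.mem_support_iff.1 h)
    · exact (DFinsupp.notMem_support_iff.1 h).symm
  right_inv P := by
    ext i
    simp [DFinsupp.mk_apply]

theorem mem_supportEquiv (x : G2) (i : ℕ) : i ∈ supportEquiv x ↔ x i ≠ 0 :=
  DFinsupp.mem_support_iff

theorem supportEquiv_add (x y : G2) :
    supportEquiv (x + y) = symmDiff (supportEquiv x) (supportEquiv y) := by
  ext i
  simp only [Finset.mem_symmDiff, mem_supportEquiv, DirectSum.add_apply]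
  generalize x i = a
  generalize y i = b
  revert a b
  decide

theorem supportEquiv_sub (x y : G2) :
    supportEquiv (x - y) = symmDiff (supportEquiv x) (supportEquiv y) := by
  ext i
  simp only [Finset.mem_symmDiff, mem_supportEquiv, DirectSum.sub_apply]
  generalize x i = a
  generalize y i = b
  revert a b
  decide

/-- The elements of `G2` supported in `range n`. -/
def initialSubgroup (n : ℕ) : Finset G2 :=
  (Finset.range n).powerset.map supportEquiv.symm.toEmbedding

theorem mem_initialSubgroup {n : ℕ} {x : G2} :
    x ∈ initialSubgroup n ↔ supportEquiv x ⊆ Finset.range n := by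
  simp [initialSubgroup, Finset.mem_map_equiv]

theorem card_initialSubgroup (n : ℕ) : (initialSubgroup n).card = 2 ^ n := by
  simp [initialSubgroup]

/-- These sets are increasing subgroups that exhaust `G2`, so the ratio is exactly 1 once `g` lies
in them. -/
theorem isFolnerSeq_initialSubgroup {m : ℕ → ℕ} (hm : StrictMono m) :
    IsFolnerSeq fun j => initialSubgroup (m j) := by
  intro g
  obtain ⟨b, hb⟩ : ∃ b, supportEquiv g ⊆ Finset.range b := (supportEquiv g).exists_nat_subset_range
  refine tendsto_const_nhds.congr' ?_
  filter_upwards [eventually_ge_atTop b] with j hj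
  have hg : supportEquiv g ⊆ Finset.range (m j) :=
    hb.trans (Finset.range_subset_range.2 (hj.trans hm.le_apply))
  have h : ((initialSubgroup (m j) : Set G2) + {g}) ∩ (initialSubgroup (m j) : Set G2) =
      initialSubgroup (m j) := by
    refine Set.inter_eq_right.2 fun x hx => ?_
    refine Set.mem_add.2 ⟨x - g, ?_, g, rfl, sub_add_cancel x g⟩
    rw [Finset.mem_coe, mem_initialSubgroup] at hx ⊢
    rw [supportEquiv_sub]
    exact symmDiff_le_sup.trans (Finset.union_subset hx hg)
  rw [h, Set.ncard_coe_finset, card_initialSubgroup, div_self (by positivity)]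

theorem ncard_inter_div_card_le_one {G : Type*} (A : Set G) (F : Finset G) :
    ((A ∩ (F : Set G)).ncard : ℝ) / (F.card : ℝ) ≤ 1 := by
  refine div_le_one_of_le₀ ?_ (by positivity)
  rw [← Set.ncard_coe_finset]
  exact_mod_cast Set.ncard_le_ncard Set.inter_subset_right F.finite_toSet

theorem upperDensity_le_one {G : Type*} [AddCommGroup G] (Φ : ℕ → Finset G) (A : Set G) :
    upperDensity Φ A ≤ 1 :=
  limsup_le_of_le (isCoboundedUnder_le_of_le atTop (x := 0) fun _ => by positivity)
    (Eventually.of_forall fun n => ncard_inter_div_card_le_one A (Φ n))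

theorem le_upperBanachDensity {G : Type*} [AddCommGroup G] {Φ : ℕ → Finset G} {A : Set G} {δ : ℝ}
    (hΦ : IsFolnerSeq Φ) (h : ∀ n, δ ≤ ((A ∩ (Φ n : Set G)).ncard : ℝ) / ((Φ n).card : ℝ)) :
    δ ≤ upperBanachDensity A := by
  refine le_trans ?_ (le_csSup (a := upperDensity Φ A) ⟨1, ?_⟩ ⟨Φ, hΦ, rfl⟩)
  · exact le_limsup_of_frequently_le (Frequently.of_forall h)
      (isBoundedUnder_of ⟨1, fun n => ncard_inter_div_card_le_one A (Φ n)⟩)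
  · rintro _ ⟨Ψ, -, rfl⟩
    exact upperDensity_le_one Ψ A

/-- For a piecewise syndetic set `B` there is a finite colouring such that differences of elements
of the same colour lie in `B - B`. -/
theorem IsPiecewiseSyndetic.exists_coloring {G : Type*} [AddCommGroup G] {B : Set G}
    (hB : IsPiecewiseSyndetic B) :
    ∃ (k : ℕ) (c : G → ℕ), (∀ x, c x < k) ∧ ∀ x y, c x = c y → x - y ∈ B - B := by
  obtain ⟨S, ⟨F, hF⟩, hS⟩ := hB
  have hcover : ∀ x : G, ∃ f : F, x - f ∈ S := fun x => by
    obtain ⟨s, hs, f, hf, rfl⟩ := Set.mem_add.1 (hF ▸ Set.mem_univ x : x ∈ S + (F : Set G))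
    exact ⟨⟨f, hf⟩, by simpa using hs⟩
  choose f hf using hcover
  refine ⟨F.card, fun x => F.equivFin (f x), fun x => (F.equivFin (f x)).2, fun x y hxy => ?_⟩
  have hfe : f x = f y := F.equivFin.injective (Fin.ext hxy)
  classical
  -- The colour of `x` records an `f ∈ F` with `x - f ∈ S`. For two points of one colour, `f` and
  -- the translation into `B` both cancel in the difference.
  obtain ⟨g, hg⟩ := hS {x - f x, y - f y} (by
    simp only [Finset.coe_insert, Finset.coe_singleton, Set.insert_subset_iff,
      Set.singleton_subset_iff]
    exact ⟨hf x, hf y⟩)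
  refine Set.mem_sub.2 ⟨x - f x + g, hg (Set.add_mem_add (by simp) rfl), y - f y + g,
    hg (Set.add_mem_add (by simp) rfl), ?_⟩
  rw [hfe]; abel

theorem theorem1p2 (ε : ℝ) (hε : 0 < ε) :
    ∃ A : Set G2, upperBanachDensity A > 1 / 2 - ε ∧
      ¬ ∃ (B : Set G2) (g : G2), IsPiecewiseSyndetic B ∧ (B - B) + {g} ⊆ A - A := by
  classical
  obtain ⟨m, A, hm, hdens, hrec⟩ := exists_family_avoiding (half_pos hε)
  refine ⟨supportEquiv ⁻¹' A, ?_, ?_⟩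
  · refine lt_of_lt_of_le (by linarith : 1 / 2 - ε < 1 / 2 - ε / 2)
      (le_upperBanachDensity (isFolnerSeq_initialSubgroup hm) fun j => ?_)
    have h : supportEquiv ⁻¹' A ∩ (initialSubgroup (m j) : Set G2) =
        (((Finset.range (m j)).powerset.filter (· ∈ A)).map supportEquiv.symm.toEmbedding :
          Finset G2) := by
      ext x
      simp [mem_initialSubgroup, and_comm]
    rw [h, Set.ncard_coe_finset, Finset.card_map, card_initialSubgroup, le_div_iff₀ (by positivity)]
    exact_mod_cast hdens j
  · rintro ⟨B, g, hB, hsub⟩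
    obtain ⟨k, c, hc, hcB⟩ := hB.exists_coloring
    obtain ⟨P, Q, hPQ, hav⟩ := hrec k (supportEquiv g) (fun P => c (supportEquiv.symm P))
      fun P => hc _
    obtain ⟨a, ha, b, hb, hab⟩ := Set.mem_sub.1
      (hsub (Set.add_mem_add (hcB _ _ hPQ) (Set.mem_singleton g)))
    have h := congrArg supportEquiv hab
    rw [supportEquiv_sub, supportEquiv_add, supportEquiv_sub, Equiv.apply_symm_apply,
      Equiv.apply_symm_apply] at h
    refine hav _ ha ?_
    rw [← h, symmDiff_symmDiff_cancel_left]
    exact hb
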